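/- **Setting.** Let $X\subset\mathbb{R}^d$ be convex and compact, $C\subset(0,\infty)$, and $e\in\mathbb{R}^d$. A user is a pair $(x,c)\in X\times C$. A moderator is a function $f:\mathbb{R}^d\to\mathbb{R}$; it filters $z$ if $f(z)>0$, and $z$ is benign if $f(z)\le 0$ (a $\{0,1\}$-valued moderator is the special case where $1$ means filtered). The utility of publishing $z$ is $$u(z;(x,c),e,f)=\mathbb{I}[f(z)\le 0]\, z^{\top}e-c\|z-x\|_2^2 ,$$ and the best response $\Delta(x,c;e,f)$ is a maximizer of $u(\cdot\,;(x,c),e,f)$ over $X$, chosen as a function of $x,c,e$ and the benign region of $f$ (and set to $x$ if no maximizer exists). The social distortion is $D(f;(x,c),e)=\|x-\Delta(x,c;e,f)\|_2^2$ if $f(x)\le 0$ and $0$ otherwise. With $\perp$ the trivial moderator that marks everything benign, the distortion mitigation of $f$ is $$h(f;e,x,c)=D(\perp;(x,c),e)\cdot\mathbb{I}[f(x)\le 0]-D(f;(x,c),e).$$ For a class $\mathcal F$ of moderators let $\mathcal H_{\mathcal F}=\{h(f;e,\cdot): f\in\mathcal F\}$, a class of functions on $X\times C$. $\mathrm{VCDim}(\mathcal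 F)$ is the VC dimension on $\mathbb{R}^d$ of the set family $\{\{z:f(z)>0\}:f\in\mathcal F\}$. $\mathrm{PDim}(\mathcal H_{\mathcal F})$ is the largest size of a finite set $\{u_1,\dots,u_m\}$ of distinct points for which there are thresholds $\gamma_1,\dots,\gamma_m$ such that for every $T\subseteq\{1,\dots,m\}$ some $h\in\mathcal H_{\mathcal F}$ satisfies $h(u_i)\ge\gamma_i\iff i\in T$. **Theorem.** There is a universal constant $K>0$ such that the following holds. Let $d,X,C,e$ be as above and let $\mathcal F$ be any class of moderators for which all functions in $\mathcal H_{\mathcal F}$ take values in $[0,H]$ and both $\mathrm{PDim}(\mathcal H_{\mathcal F})$ and $\mathrm{VCDim}(\mathcal F)$ are finite. Let $\mathcal U$ be any probability distribution on $X\times C$ for which $\mathcal H_{\mathcal F}$ and $\{(x,c)\mapsto\mathbb{I}[f(x+\frac{e}{2c})>0]: f\in\mathcal F\}$ satisfy the usual measurability condition: the members $g$ of each class are measurable, and so is the map $(u_1,\dots,u_m)\mapsto\sup_{g}\left|\sum_{i\le m} a_i g(u_i)\right|$ for all $m$ and all real weights $a_i$, up to null sets. Let $\varepsilon>0$ and $\delta\in(0,1)$,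 with $\delta\le\frac12$ in the degenerate case $\mathrm{PDim}(\mathcal H_{\mathcal F})=0$. If $$n\ \ge\ \frac{K}{\varepsilon^2}\Big(H^2\,\mathrm{PDim}(\mathcal H_{\mathcal F})+\max(1,H^2)\ln(1/\delta)+\mathrm{VCDim}(\mathcal F)\Big),$$ which for $H\ge1$ is $\frac{K}{\varepsilon^2}\big(H^2(\mathrm{PDim}(\mathcal H_{\mathcal F})+\ln(1/\delta))+\mathrm{VCDim}(\mathcal F)\big)$, then with probability at least $1-\delta$ over an i.i.d. sample $(x_1,c_1),\dots,(x_n,c_n)$ from $\mathcal U$, simultaneously for all $f\in\mathcal F$, $$\Big|\frac1n\sum_{i=1}^n h(f;e,x_i,c_i)-\mathbb{E}_{(x,c)\sim\mathcal U}[h(f;e,x,c)]\Big|\le\varepsilon$$ and $$\Big|\frac1n\sum_{i=1}^n \mathbb{I}\big[f(x_i+\tfrac{e}{2c_i})>0\big]-\Pr_{(x,c)\sim\mathcal U}\big[f(x+\tfrac{e}{2c})>0\big]\Big|\le\varepsilon .$$ (That is, the outer probability that some $f\in\mathcal F$ violates one of the two inequalities is at most $\delta$.) -/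

import Mathlib

open MeasureTheory

noncomputable section

namespace StrategicFiltering

/-- Feature vectors of content, with the Euclidean norm and inner product. -/
abbrev Content (d : ℕ) : Type := EuclideanSpace ℝ (Fin d)

/-! ### The model

A moderator is a harmfulness score `f`; the content `z` is benign if `f z ≤ 0` and is filtered if
`0 < f z`. A moderator with values in `{0, 1}` is the special case in which `1` means filtered. -/

/-- Utility of publishing `z` for a user with original content `x` and manipulation cost `c`,
under the trend `e` and the moderator `f`. -/
def utility {d : ℕ} (e : Content d) (f : Content d → ℝ) (x : Content d) (c : ℝ)
    (z : Content d) : ℝ :=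
  (if f z ≤ 0 then inner ℝ z e else 0) - c * ‖z - x‖ ^ 2

/-- `z` maximizes the utility of the user `(x, c)` over the content space `X`. -/
def IsBestResponse {d : ℕ} (X : Set (Content d)) (e : Content d) (f : Content d → ℝ)
    (x : Content d) (c : ℝ) (z : Content d) : Prop :=
  z ∈ X ∧ IsMaxOn (utility e f x c) X z

open Classical in
/-- The best response `Δ(x, c; e, f)`: a maximizer of the utility over `X`. (If the supremum is not
attained, the user is taken to publish `x`.) -/
def bestResponse {d : ℕ} (X : Set (Content d)) (e : Content d) (f : Content d → ℝ)
    (x : Content d) (c : ℝ) : Content d :=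
  if h : ∃ z, IsBestResponse X e f x c z then h.choose else x

theorem bestResponse_spec {d : ℕ} {X : Set (Content d)} {e : Content d} {f : Content d → ℝ}
    {x : Content d} {c : ℝ} (h : ∃ z, IsBestResponse X e f x c z) :
    IsBestResponse X e f x c (bestResponse X e f x c) := by
  unfold bestResponse
  rw [dif_pos h]
  exact h.choose_spec

/-- The social distortion `D(f; (x, c), e)`. -/
def socialDistortion {d : ℕ} (X : Set (Content d)) (e : Content d) (f : Content d → ℝ)
    (x : Content d) (c : ℝ) : ℝ :=
  if f x ≤ 0 then ‖x - bestResponse X e f x c‖ ^ 2 else 0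

/-- The trivial moderator `⊥`, for which every content is benign. -/
def trivialModerator (d : ℕ) : Content d → ℝ := fun _ => 0

/-- The distortion mitigation
`h(f; e, x, c) = D(⊥; (x, c), e) · 𝟙[f x ≤ 0] - D(f; (x, c), e)`. -/
def mitigation {d : ℕ} (X : Set (Content d)) (e : Content d) (f : Content d → ℝ)
    (x : Content d) (c : ℝ) : ℝ :=
  socialDistortion X e (trivialModerator d) x c * (if f x ≤ 0 then 1 else 0)
    - socialDistortion X e f x c

/-- The content `x + e / (2 c)` that the user would publish if nothing were ever filtered. -/
def idealPoint {d : ℕ} (e : Content d) (x : Content d) (c : ℝ) : Content d :=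
  x + (1 / (2 * c)) • e

/-- `h(f; e, ·)` as a function of the user `u = (x, c) ∈ X × C`. -/
def mitigationOn {d : ℕ} (X : Set (Content d)) (C : Set ℝ) (e : Content d)
    (f : Content d → ℝ) (u : X × C) : ℝ :=
  mitigation X e f u.1 u.2

/-- The indicator that the ideally manipulated content of the user `u = (x, c) ∈ X × C` is
filtered, `𝟙[f (x + e / (2 c)) > 0]`. -/
def filteredOn {d : ℕ} (X : Set (Content d)) (C : Set ℝ) (e : Content d)
    (f : Content d → ℝ) (u : X × C) : ℝ :=
  if 0 < f (idealPoint e u.1 u.2) then 1 else 0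

/-! ### Combinatorial dimensions -/

/-- `𝒢` P-shatters the finite set `s`: for some thresholds on `s`, all above/below patterns on `s`
are realized by functions of `𝒢`. -/
def PShatters {Z : Type*} (𝒢 : Set (Z → ℝ)) (s : Finset Z) : Prop :=
  ∃ γ : Z → ℝ, ∀ T : Finset Z, T ⊆ s → ∃ g ∈ 𝒢, ∀ z ∈ s, γ z ≤ g z ↔ z ∈ T

/-- Pollard's pseudo-dimension. -/
def PDim {Z : Type*} (𝒢 : Set (Z → ℝ)) : ℕ∞ :=
  ⨆ (s : Finset Z) (_ : PShatters 𝒢 s), (s.card : ℕ∞)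

/-- `F` shatters the finite set `s`: all filtered/benign labelings of `s` are realized by
moderators of `F`. -/
def Shatters {Z : Type*} (F : Set (Z → ℝ)) (s : Finset Z) : Prop :=
  ∀ T : Finset Z, T ⊆ s → ∃ f ∈ F, ∀ z ∈ s, 0 < f z ↔ z ∈ T

/-- The Vapnik–Chervonenkis dimension of the class of filtered/benign labelings given by `F`. -/
def VCDim {Z : Type*} (F : Set (Z → ℝ)) : ℕ∞ :=
  ⨆ (s : Finset Z) (_ : Shatters F s), (s.card : ℕ∞)

/-! ### Samples -/

/-- The average of `g` over the sample `U`. -/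
def empiricalMean {Z : Type*} {n : ℕ} (g : Z → ℝ) (U : Fin n → Z) : ℝ :=
  (∑ i, g (U i)) / n

/-- The standard measurability condition on a class of functions in uniform laws of large numbers:
the members of `𝒢` are measurable, and so are the suprema over `𝒢` of the absolute values of
weighted sums over finite samples (all up to null sets). -/
def IsMeasurableClass {Z : Type*} [MeasurableSpace Z] (μ : Measure Z) (𝒢 : Set (Z → ℝ)) : Prop :=
  (∀ g ∈ 𝒢, AEMeasurable g μ) ∧
    ∀ (n : ℕ) (a : Fin n → ℝ),
      AEMeasurable (fun U : Fin n → Z => ⨆ g : 𝒢, |∑ i, a i * (g : Z → ℝ) (U i)|)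
        (Measure.pi fun _ => μ)

end StrategicFiltering

end

open MeasureTheory

namespace StrategicFiltering

/-! ### Packing numbers of classes of finite pseudo-dimension -/

/-! Both inequalities are uniform laws of large numbers for bounded classes of finite
pseudo-dimension, obtained from `measure_uniform_deviation_le` at confidence δ/2 each and a union
bound. The model enters only through two facts: the pseudo-dimension of the filtering indicators is
at most the VC dimension of the moderators, and the mitigation is determined by the benign region.

A union bound over a single net would cost a logarithm of 1/ε; chaining avoids it. Random thresholds
and Sauer–Shelah bound L¹ packing numbers at scale τ by (144/τ²)^P (`card_le_of_separated`), so a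
net at scale 4^{-k} has log-cardinality O(P(k+1)). For values in [0, 1] an L¹ bound also bounds
squared L² distances, hence Hoeffding's variance proxy for a link at level k is O(n 4^{-k}).
Allowing that link the deviation nε(k+1)2^{-k}/32 gives a failure exponent of order nε²(k+1)², which
beats the entropy at every level, while the allowances remain summable
(`card_exists_lt_abs_signedSum`).

Symmetrization with a ghost sample passes from random signs to the true mean: exchanging paired
points preserves the product measure, and Chebyshev keeps the ghost mean close with probability at
least one half. -/

theorem sum_choose_le_pow {m P : ℕ} (hP : 1 ≤ P) (hm : P ≤ m) :
    ∑ k ∈ Finset.range (P + 1), (m.choose k : ℝ) ≤ (Real.exp 1 * (m / P)) ^ P := by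
  have hP0 : (0 : ℝ) < P := by exact_mod_cast hP
  have hm0 : (0 : ℝ) < m := by exact_mod_cast (hP.trans hm)
  have hx : (P : ℝ) / m ≤ 1 := by
    rw [div_le_one hm0]; exact_mod_cast hm
  have hx0 : (0 : ℝ) < P / m := by positivity
  -- Since P/m ≤ 1, the weight (P/m)^P is at most (P/m)^k for k ≤ P; the sum then completes to the
  -- binomial expansion of (1 + P/m)^m ≤ e^P.
  have key : (∑ k ∈ Finset.range (P + 1), (m.choose k : ℝ)) * ((P : ℝ) / m) ^ P
      ≤ Real.exp 1 ^ P := by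
    calc (∑ k ∈ Finset.range (P + 1), (m.choose k : ℝ)) * ((P : ℝ) / m) ^ P
        ≤ ∑ k ∈ Finset.range (P + 1), ((P : ℝ) / m) ^ k * m.choose k := by
          rw [Finset.sum_mul]
          refine Finset.sum_le_sum fun k hk => ?_
          rw [mul_comm]
          refine mul_le_mul_of_nonneg_right ?_ (by positivity)
          exact pow_le_pow_of_le_one hx0.le hx (by simpa [Nat.lt_succ_iff] using hk)
      _ ≤ ∑ k ∈ Finset.range (m + 1), ((P : ℝ) / m) ^ k * m.choose k := by
          refine Finset.sum_le_sum_of_subset_of_nonneg ?_ fun k _ _ => by positivity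
          exact Finset.range_subset_range.2 (by omega)
      _ = ((P : ℝ) / m + 1) ^ m := by
          rw [add_pow]; simp
      _ ≤ Real.exp (P / m) ^ m := by
          gcongr
          exact Real.add_one_le_exp _
      _ = Real.exp 1 ^ P := by
          rw [← Real.exp_nat_mul, ← Real.exp_nat_mul]
          congr 1
          field_simp
  have h2 : (Real.exp 1 * ((m : ℝ) / P)) ^ P = Real.exp 1 ^ P / ((P : ℝ) / m) ^ P := by
    rw [← div_pow]; congr 1; field_simp
  rw [h2, le_div_iff₀ (by positivity)]
  exact key

/-- A uniform threshold in (0, 1] falls between a and b with probability |a - b|; this turns L¹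
distance into a probability of separation. -/
theorem integral_indicator_separates {a b : ℝ} (ha : a ∈ Set.Icc (0 : ℝ) 1)
    (hb : b ∈ Set.Icc (0 : ℝ) 1) :
    ∫ t in Set.Ioc (0 : ℝ) 1, (if ¬ (t ≤ a ↔ t ≤ b) then (1 : ℝ) else 0) = |a - b| := by
  have h : (fun t : ℝ => if ¬ (t ≤ a ↔ t ≤ b) then (1 : ℝ) else 0)
      = (Set.Ioc (min a b) (max a b)).indicator fun _ => 1 := by
    funext t
    simp only [Set.indicator, Set.mem_Ioc, min_lt_iff, le_max_iff]
    refine if_congr ?_ rfl rfl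
    by_cases h1 : t ≤ a <;> by_cases h2 : t ≤ b <;> simp [h1, h2] <;> grind
  rw [h, setIntegral_indicator measurableSet_Ioc]
  have : Set.Ioc (0 : ℝ) 1 ∩ Set.Ioc (min a b) (max a b) = Set.Ioc (min a b) (max a b) := by
    refine Set.inter_eq_right.2 (Set.Ioc_subset_Ioc (le_min ha.1 hb.1) (max_le ha.2 hb.2))
  rw [this]
  simp [max_sub_min_eq_abs']

theorem exists_separating_point {Z ι : Type*} [Fintype ι] [Nonempty ι] (w : ι → Z)
    (D : Finset ((Z → ℝ) × (Z → ℝ))) {τ : ℝ}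
    (h01 : ∀ p ∈ D, (∀ z, p.1 z ∈ Set.Icc (0 : ℝ) 1) ∧ ∀ z, p.2 z ∈ Set.Icc (0 : ℝ) 1)
    (hD : ∀ p ∈ D, τ * Fintype.card ι ≤ ∑ i, |p.1 (w i) - p.2 (w i)|) :
    ∃ (z : Z) (t : ℝ), τ * D.card
      ≤ ((D.filter fun p => ¬ (t ≤ p.1 z ↔ t ≤ p.2 z)).card : ℝ) := by
  obtain ⟨i, -, hi⟩ : ∃ i ∈ Finset.univ, τ * D.card ≤ ∑ p ∈ D, |p.1 (w i) - p.2 (w i)| := by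
    refine Finset.exists_le_of_sum_le (s := (Finset.univ : Finset ι)) Finset.univ_nonempty ?_
    rw [Finset.sum_comm]
    calc ∑ i : ι, τ * D.card = ∑ p ∈ D, τ * Fintype.card ι := by
          simp; ring
      _ ≤ _ := Finset.sum_le_sum hD
  have hprob : IsProbabilityMeasure (volume.restrict (Set.Ioc (0 : ℝ) 1)) := ⟨by simp⟩
  have hint : ∀ p ∈ D, Integrable
      (fun t : ℝ => if ¬ (t ≤ p.1 (w i) ↔ t ≤ p.2 (w i)) then (1 : ℝ) else 0)
      (volume.restrict (Set.Ioc (0 : ℝ) 1)) := by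
    intro p _
    refine Integrable.of_bound (C := 1) ?_ (Filter.Eventually.of_forall fun t => ?_)
    · refine (Measurable.ite ?_ measurable_const measurable_const).aestronglyMeasurable
      exact (MeasurableSet.iff measurableSet_Iic measurableSet_Iic).compl
    · split_ifs <;> simp
  obtain ⟨t, ht⟩ := exists_integral_le (integrable_finsetSum D hint)
  rw [integral_finsetSum D hint] at ht
  refine ⟨w i, t, hi.trans (le_trans (le_of_eq ?_) (ht.trans (le_of_eq ?_)))⟩
  · exact Finset.sum_congr rfl fun p hp =>
      (integral_indicator_separates ((h01 p hp).1 _) ((h01 p hp).2 _)).symm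
  · rw [Finset.card_filter]; push_cast; rfl

/-- Derandomized greedy choice: averaging over sample points and thresholds, some pair (point,
threshold) separates at least a fraction τ of the pairs still unseparated, so each step shrinks
their number by 1 - τ. -/
theorem exists_separating_points {Z ι : Type*} [Fintype ι] [Nonempty ι] (w : ι → Z)
    (D : Finset ((Z → ℝ) × (Z → ℝ))) {τ : ℝ} (hτ : τ ≤ 1)
    (h01 : ∀ p ∈ D, (∀ z, p.1 z ∈ Set.Icc (0 : ℝ) 1) ∧ ∀ z, p.2 z ∈ Set.Icc (0 : ℝ) 1)
    (hD : ∀ p ∈ D, τ * Fintype.card ι ≤ ∑ i, |p.1 (w i) - p.2 (w i)|) (m : ℕ) :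
    ∃ y : Fin m → Z × ℝ,
      ((D.filter fun p => ∀ i, (y i).2 ≤ p.1 (y i).1 ↔ (y i).2 ≤ p.2 (y i).1).card : ℝ)
        ≤ (1 - τ) ^ m * D.card := by
  induction m with
  | zero => exact ⟨Fin.elim0, by simp⟩
  | succ m ih =>
    obtain ⟨y, hy⟩ := ih
    set D' := D.filter fun p => ∀ i, (y i).2 ≤ p.1 (y i).1 ↔ (y i).2 ≤ p.2 (y i).1 with hD'
    have hsub : D' ⊆ D := Finset.filter_subset _ _
    obtain ⟨z, t, hzt⟩ := exists_separating_point w D' (τ := τ)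
      (fun p hp => h01 p (hsub hp)) (fun p hp => hD p (hsub hp))
    refine ⟨Fin.cons (z, t) y, ?_⟩
    have hset : (D.filter fun p => ∀ i, ((Fin.cons (z, t) y : Fin (m + 1) → Z × ℝ) i).2
          ≤ p.1 ((Fin.cons (z, t) y : Fin (m + 1) → Z × ℝ) i).1 ↔
          ((Fin.cons (z, t) y : Fin (m + 1) → Z × ℝ) i).2
          ≤ p.2 ((Fin.cons (z, t) y : Fin (m + 1) → Z × ℝ) i).1)
        = D'.filter fun p => (t ≤ p.1 z ↔ t ≤ p.2 z) := by
      rw [hD', Finset.filter_filter]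
      refine Finset.filter_congr fun p _ => ?_
      rw [Fin.forall_fin_succ]
      simp [and_comm]
    rw [hset]
    have hcard := Finset.card_filter_add_card_filter_not (s := D')
      (fun p => (t ≤ p.1 z ↔ t ≤ p.2 z))
    have hcard' : ((D'.filter fun p => (t ≤ p.1 z ↔ t ≤ p.2 z)).card : ℝ)
        + ((D'.filter fun p => ¬ (t ≤ p.1 z ↔ t ≤ p.2 z)).card : ℝ) = D'.card := by
      exact_mod_cast hcard
    calc ((D'.filter fun p => (t ≤ p.1 z ↔ t ≤ p.2 z)).card : ℝ)
        ≤ (1 - τ) * D'.card := by linarith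
      _ ≤ (1 - τ) * ((1 - τ) ^ m * D.card) :=
          mul_le_mul_of_nonneg_left hy (by linarith)
      _ = _ := by ring

/-- Each function is encoded by the set of indices whose threshold it reaches. The encoding is
injective on `S`, an index set shattered by the codes yields a P-shattered set of points, and
Sauer–Shelah counts the codes. -/
theorem card_le_sum_choose_of_separated {Z : Type*} {𝒢 : Set (Z → ℝ)} {P m : ℕ}
    (hP : ∀ s : Finset Z, PShatters 𝒢 s → s.card ≤ P) (S : Finset (Z → ℝ)) (hS : ↑S ⊆ 𝒢)
    (y : Fin m → Z × ℝ)
    (hy : ∀ g ∈ S, ∀ g' ∈ S,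
      (∀ i, (y i).2 ≤ g (y i).1 ↔ (y i).2 ≤ g' (y i).1) → g = g') :
    S.card ≤ ∑ k ∈ Finset.range (P + 1), m.choose k := by
  classical
  let φ : (Z → ℝ) → Finset (Fin m) := fun g => Finset.univ.filter fun i => (y i).2 ≤ g (y i).1
  have hmem : ∀ g i, i ∈ φ g ↔ (y i).2 ≤ g (y i).1 := by intro g i; simp [φ]
  have hinj : Set.InjOn φ S := by
    intro g hg g' hg' h
    refine hy g hg g' hg' fun i => ?_
    rw [← hmem, ← hmem, h]
  rw [← Finset.card_image_of_injOn hinj]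
  have hvc : (S.image φ).vcDim ≤ P := by
    refine Finset.sup_le fun s hs => ?_
    rw [Finset.mem_shatterer] at hs
    have hpat : ∀ t ⊆ s, ∃ g ∈ S, ∀ i ∈ s, (y i).2 ≤ g (y i).1 ↔ i ∈ t := by
      intro t ht
      obtain ⟨u, hu, hut⟩ := hs ht
      obtain ⟨g, hg, rfl⟩ := Finset.mem_image.1 hu
      refine ⟨g, hg, fun i hi => ?_⟩
      rw [← hmem, ← hut, Finset.mem_inter]
      tauto
    have hinj2 : Set.InjOn (fun i => (y i).1) s := by
      -- Two thresholds at the same point cannot both be shattered: reaching the larger forces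
      -- reaching the smaller, so the pattern {j} is impossible unless i = j.
      have aux : ∀ i ∈ s, ∀ j ∈ s, (y i).1 = (y j).1 → (y i).2 ≤ (y j).2 → i = j := by
        intro i hi j hj hij hle
        by_contra hne
        obtain ⟨g, -, hg⟩ := hpat {j} (by simpa using hj)
        have h1 := (hg j hj).2 (by simp)
        have h2 := (hg i hi).1 (by rw [hij]; exact hle.trans h1)
        exact hne (by simpa using h2)
      intro i hi j hj hij
      rcases le_total (y i).2 (y j).2 with h | h
      · exact aux i hi j hj hij h
      · exact (aux j hj i hi hij.symm h).symm
    rw [← Finset.card_image_of_injOn hinj2]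
    refine hP _ ?_
    have hγ : ∃ γ : Z → ℝ, ∀ i ∈ s, γ (y i).1 = (y i).2 := by
      refine ⟨fun z => if h : ∃ i ∈ s, (y i).1 = z then (y h.choose).2 else 0, fun i hi => ?_⟩
      have h : ∃ j ∈ s, (y j).1 = (y i).1 := ⟨i, hi, rfl⟩
      simp only [dif_pos h]
      rw [hinj2 h.choose_spec.1 hi h.choose_spec.2]
    obtain ⟨γ, hγ⟩ := hγ
    refine ⟨γ, fun T _ => ?_⟩
    obtain ⟨g, hg, hgt⟩ := hpat (s.filter fun i => (y i).1 ∈ T) (Finset.filter_subset _ _)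
    refine ⟨g, hS hg, fun z hz => ?_⟩
    obtain ⟨i, hi, rfl⟩ := Finset.mem_image.1 hz
    rw [hγ i hi, hgt i hi]
    simp [hi]
  calc (S.image φ).card ≤ (S.image φ).shatterer.card := Finset.card_le_card_shatterer _
    _ ≤ ∑ k ∈ Finset.Iic (S.image φ).vcDim, (Fintype.card (Fin m)).choose k :=
        Finset.card_shatterer_le_sum_vcDim
    _ ≤ ∑ k ∈ Finset.range (P + 1), m.choose k := by
        rw [Fintype.card_fin]
        refine Finset.sum_le_sum_of_subset fun k hk => ?_
        simp only [Finset.mem_Iic, Finset.mem_range] at hk ⊢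
        omega

/-- The packing numbers, in the `L¹` distance of a finite sample, of a class of functions with
values in `[0, 1]` are polynomial in the inverse of the scale, with degree of the order of the
pseudo-dimension. -/
theorem card_le_of_separated {Z ι : Type*} [Fintype ι] [Nonempty ι] (w : ι → Z)
    {𝒢 : Set (Z → ℝ)} {P : ℕ} (hP1 : 1 ≤ P)
    (hP : ∀ s : Finset Z, PShatters 𝒢 s → s.card ≤ P)
    (h01 : ∀ g ∈ 𝒢, ∀ z, g z ∈ Set.Icc (0 : ℝ) 1) {τ : ℝ} (hτ0 : 0 < τ) (hτ1 : τ ≤ 1)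
    (S : Finset (Z → ℝ)) (hS : ↑S ⊆ 𝒢)
    (hsep : ∀ g ∈ S, ∀ g' ∈ S, g ≠ g' → τ * Fintype.card ι < ∑ i, |g (w i) - g' (w i)|) :
    (S.card : ℝ) ≤ (144 / τ ^ 2) ^ P := by
  classical
  rcases S.eq_empty_or_nonempty with rfl | hne
  · simp; positivity
  have hP0 : (0 : ℝ) < P := by exact_mod_cast hP1
  have hPge : (1 : ℝ) ≤ P := by exact_mod_cast hP1
  set N : ℝ := (S.card : ℝ) with hN
  have hN1 : 1 ≤ N := by
    rw [hN]; exact_mod_cast hne.card_pos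
  have hN0 : 0 < N := by linarith
  have hlog : 0 ≤ Real.log N := Real.log_nonneg hN1
  -- More than 2 log N / τ points make (1 - τ)^m N² < 1, so every pair is separated; the summand P
  -- ensures P ≤ m for the binomial estimate.
  set m : ℕ := ⌊2 * Real.log N / τ⌋₊ + P with hm
  have hfl0 : 0 ≤ 2 * Real.log N / τ := by positivity
  have hm_le : (m : ℝ) ≤ 2 * Real.log N / τ + P := by
    rw [hm]; push_cast; linarith [Nat.floor_le hfl0]
  have hm_gt : 2 * Real.log N / τ < m := by
    have := Nat.lt_floor_add_one (2 * Real.log N / τ)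
    rw [hm]; push_cast; linarith
  obtain ⟨y, hy⟩ := exists_separating_points w S.offDiag hτ1
    (fun p hp => ⟨h01 _ (hS (Finset.mem_offDiag.1 hp).1), h01 _ (hS (Finset.mem_offDiag.1 hp).2.1)⟩)
    (fun p hp => by
      obtain ⟨h1, h2, h3⟩ := Finset.mem_offDiag.1 hp
      exact (hsep _ h1 _ h2 h3).le) m
  have hoff : (S.offDiag.card : ℝ) ≤ N ^ 2 := by
    have h : S.offDiag.card ≤ S.card * S.card := by rw [Finset.offDiag_card]; omega
    rw [hN, sq]; exact_mod_cast h
  have hlt : (1 - τ) ^ m * (S.offDiag.card : ℝ) < 1 := by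
    calc (1 - τ) ^ m * (S.offDiag.card : ℝ) ≤ Real.exp (-τ) ^ m * N ^ 2 := by
          refine mul_le_mul (pow_le_pow_left₀ (by linarith) (Real.one_sub_le_exp_neg τ) m) hoff
            (by positivity) (by positivity)
      _ = Real.exp (-(τ * m) + 2 * Real.log N) := by
          rw [Real.exp_add, ← Real.exp_nat_mul, two_mul, Real.exp_add, Real.exp_log hN0, sq]
          congr 2; ring
      _ < 1 := by
          rw [Real.exp_lt_one_iff]
          rw [div_lt_iff₀ hτ0] at hm_gt
          linarith
  have hcard0 : (S.offDiag.filter fun p =>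
      ∀ i, (y i).2 ≤ p.1 (y i).1 ↔ (y i).2 ≤ p.2 (y i).1).card = 0 := by
    have : ((S.offDiag.filter fun p =>
      ∀ i, (y i).2 ≤ p.1 (y i).1 ↔ (y i).2 ≤ p.2 (y i).1).card : ℝ) < 1 := hy.trans_lt hlt
    exact Nat.lt_one_iff.1 (by exact_mod_cast this)
  rw [Finset.card_eq_zero, Finset.filter_eq_empty_iff] at hcard0
  have hsauer := card_le_sum_choose_of_separated hP S hS y (by
    intro g hg g' hg' h
    by_contra hgg
    exact hcard0 (x := (g, g')) (Finset.mem_offDiag.2 ⟨hg, hg', hgg⟩) h)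
  have hbound : N ≤ (Real.exp 1 * (m / P)) ^ P := by
    refine le_trans ?_ (sum_choose_le_pow hP1 (by omega : P ≤ m))
    rw [hN]; exact_mod_cast hsauer
  -- The bound on N contains log N through m. With N = x^{2P} and log x ≤ x - 1 it becomes x² ≤
  -- 12x/τ, hence x ≤ 12/τ.
  set x : ℝ := N ^ ((P : ℝ)⁻¹ / 2) with hx
  have hx1 : 1 ≤ x := Real.one_le_rpow hN1 (by positivity)
  have hxN : (x ^ 2) ^ P = N := by
    rw [← pow_mul, hx, ← Real.rpow_natCast, ← Real.rpow_mul hN0.le]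
    push_cast
    rw [show (P : ℝ)⁻¹ / 2 * (2 * P) = 1 by field_simp, Real.rpow_one]
  have hlogx : Real.log N = 2 * P * Real.log x := by
    rw [← hxN, ← pow_mul, Real.log_pow]; push_cast; ring
  have hlx : Real.log x ≤ x - 1 := Real.log_le_sub_one_of_pos (by linarith)
  have hmP : (m : ℝ) / P ≤ 4 * x / τ := by
    rw [div_le_iff₀ hP0]
    refine hm_le.trans ?_
    rw [hlogx, div_add' _ _ _ hτ0.ne', div_mul_eq_mul_div]
    gcongr
    nlinarith
  have hx2 : x ^ 2 ≤ Real.exp 1 * (m / P) := by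
    refine le_of_pow_le_pow_left₀ (by omega : P ≠ 0) (by positivity) ?_
    rw [hxN]; exact hbound
  have he : Real.exp 1 ≤ 3 := by linarith [Real.exp_one_lt_d9]
  have hxle : x ≤ 12 / τ := by
    have h1 : x ^ 2 ≤ 3 * (4 * x / τ) := hx2.trans (by gcongr)
    have h2 : x * x ≤ x * (12 / τ) := by
      calc x * x = x ^ 2 := by ring
        _ ≤ _ := h1
        _ = _ := by ring
    exact le_of_mul_le_mul_left h2 (by linarith)
  rw [← hxN]
  gcongr
  calc x ^ 2 ≤ (12 / τ) ^ 2 := by gcongr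
    _ = 144 / τ ^ 2 := by rw [div_pow]; norm_num

/-- Finite nets in the `L¹` distance of a finite sample. -/
theorem exists_net {Z ι : Type*} [Fintype ι] [Nonempty ι] (w : ι → Z)
    {𝒢 : Set (Z → ℝ)} {P : ℕ} (hP1 : 1 ≤ P)
    (hP : ∀ s : Finset Z, PShatters 𝒢 s → s.card ≤ P)
    (h01 : ∀ g ∈ 𝒢, ∀ z, g z ∈ Set.Icc (0 : ℝ) 1) {τ : ℝ} (hτ0 : 0 < τ) (hτ1 : τ ≤ 1) :
    ∃ S : Finset (Z → ℝ), ↑S ⊆ 𝒢 ∧ (S.card : ℝ) ≤ (144 / τ ^ 2) ^ P ∧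
      ∀ g ∈ 𝒢, ∃ g' ∈ S, ∑ i, |g (w i) - g' (w i)| ≤ τ * Fintype.card ι := by
  classical
  let p : Finset (Z → ℝ) → Prop := fun S => ↑S ⊆ 𝒢 ∧
    ∀ g ∈ S, ∀ g' ∈ S, g ≠ g' → τ * Fintype.card ι < ∑ i, |g (w i) - g' (w i)|
  have hb : ∀ S, p S → S.card ≤ ⌊(144 / τ ^ 2) ^ P⌋₊ := fun S hS =>
    Nat.le_floor (card_le_of_separated w hP1 hP h01 hτ0 hτ1 S hS.1 hS.2)
  -- A separated set of largest cardinality exists by the packing bound, and its maximality makes it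
  -- a net.
  obtain ⟨S, hS, hmax⟩ : ∃ S, p S ∧ ∀ S', p S' → S'.card ≤ S.card := by
    obtain ⟨S, hS, hc⟩ := Nat.findGreatest_spec (P := fun k => ∃ S, p S ∧ S.card = k)
      (n := ⌊(144 / τ ^ 2) ^ P⌋₊) (Nat.zero_le _) ⟨∅, by simp [p], rfl⟩
    refine ⟨S, hS, fun S' hS' => ?_⟩
    rw [hc]
    exact Nat.le_findGreatest (hb S' hS') ⟨S', hS', rfl⟩
  refine ⟨S, hS.1, card_le_of_separated w hP1 hP h01 hτ0 hτ1 S hS.1 hS.2, fun g hg => ?_⟩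
  by_contra! hcon
  have hgS : g ∉ S := fun h => by
    have := hcon g h
    simp at this
    have h2 : (0 : ℝ) ≤ τ * Fintype.card ι := by positivity
    linarith
  have := hmax (insert g S) ⟨by
    rw [Finset.coe_insert]; exact Set.insert_subset hg hS.1, by
    intro a ha b hb hab
    rw [Finset.mem_insert] at ha hb
    rcases ha with rfl | ha <;> rcases hb with rfl | hb
    · exact absurd rfl hab
    · exact hcon b hb
    · simp_rw [abs_sub_comm (a _)]
      exact hcon a ha
    · exact hS.2 a ha b hb hab⟩
  rw [Finset.card_insert_of_notMem hgS] at this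
  omega

/-! ### Chaining for sign-symmetrized sums -/

/-- The sum of the coordinates of `v` with the signs `σ`, where `true` is read as `+`. -/
def signedSum {n : ℕ} (σ : Fin n → Bool) (v : Fin n → ℝ) : ℝ :=
  ∑ i, (if σ i then 1 else -1) * v i

theorem signedSum_sub {n : ℕ} (σ : Fin n → Bool) (v v' : Fin n → ℝ) :
    signedSum σ (v - v') = signedSum σ v - signedSum σ v' := by
  simp [signedSum, mul_sub, Finset.sum_sub_distrib]

theorem signedSum_neg {n : ℕ} (σ : Fin n → Bool) (v : Fin n → ℝ) :
    signedSum σ (-v) = -signedSum σ v := by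
  simp [signedSum]

theorem signedSum_smul {n : ℕ} (σ : Fin n → Bool) (c : ℝ) (v : Fin n → ℝ) :
    signedSum σ (c • v) = c * signedSum σ v := by
  simp [signedSum, Finset.mul_sum, mul_left_comm]

theorem abs_signedSum_le {n : ℕ} (σ : Fin n → Bool) (v : Fin n → ℝ) :
    |signedSum σ v| ≤ ∑ i, |v i| := by
  refine (Finset.abs_sum_le_sum_abs _ _).trans (Finset.sum_le_sum fun i _ => ?_)
  cases σ i <;> simp

theorem sum_exp_signedSum {n : ℕ} (v : Fin n → ℝ) :
    ∑ σ : Fin n → Bool, Real.exp (signedSum σ v) = 2 ^ n * ∏ i, Real.cosh (v i) := by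
  calc ∑ σ : Fin n → Bool, Real.exp (signedSum σ v)
      = ∑ σ : Fin n → Bool, ∏ i, Real.exp ((if σ i then 1 else -1) * v i) := by
        simp only [signedSum, Real.exp_sum]
    _ = ∏ i, ∑ b : Bool, Real.exp ((if b then 1 else -1) * v i) :=
        (Fintype.prod_sum fun i (b : Bool) => Real.exp ((if b then 1 else -1) * v i)).symm
    _ = ∏ i, (2 * Real.cosh (v i)) := by
        refine Finset.prod_congr rfl fun i _ => ?_
        rw [Fintype.sum_bool, Real.cosh_eq]
        simp only [if_true, Bool.false_eq_true, if_false, one_mul, neg_one_mul]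
        ring
    _ = _ := by simp [Finset.prod_mul_distrib]

theorem card_lt_signedSum {n : ℕ} (v : Fin n → ℝ) {B t : ℝ} (hB : 0 < B)
    (hv : ∑ i, v i ^ 2 ≤ B) (ht : 0 ≤ t) :
    ((Finset.univ.filter fun σ : Fin n → Bool => t < signedSum σ v).card : ℝ)
      ≤ Real.exp (-(t ^ 2 / (2 * B))) * 2 ^ n := by
  -- The Chernoff parameter t/B minimizes λ²B/2 - λt.
  have hl : 0 ≤ t / B := by positivity
  have h1 : ((Finset.univ.filter fun σ : Fin n → Bool => t < signedSum σ v).card : ℝ)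
      * Real.exp (t / B * t) ≤ Real.exp (t ^ 2 / (2 * B)) * 2 ^ n := by
    calc _ = ∑ σ ∈ Finset.univ.filter fun σ : Fin n → Bool => t < signedSum σ v,
            Real.exp (t / B * t) := by simp
      _ ≤ ∑ σ ∈ Finset.univ.filter fun σ : Fin n → Bool => t < signedSum σ v,
            Real.exp (signedSum σ ((t / B) • v)) := by
          refine Finset.sum_le_sum fun σ hσ => ?_
          rw [signedSum_smul]
          exact Real.exp_le_exp.2 (mul_le_mul_of_nonneg_left (Finset.mem_filter.1 hσ).2.le hl)
      _ ≤ ∑ σ : Fin n → Bool, Real.exp (signedSum σ ((t / B) • v)) :=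
          Finset.sum_le_sum_of_subset_of_nonneg (Finset.filter_subset _ _)
            fun _ _ _ => (Real.exp_pos _).le
      _ = 2 ^ n * ∏ i, Real.cosh (t / B * v i) := sum_exp_signedSum _
      _ ≤ 2 ^ n * ∏ i, Real.exp ((t / B * v i) ^ 2 / 2) := by
          gcongr with i
          exact Real.cosh_le_exp_half_sq _
      _ = 2 ^ n * Real.exp ((t / B) ^ 2 / 2 * ∑ i, v i ^ 2) := by
          rw [← Real.exp_sum, Finset.mul_sum]
          congr 2
          exact Finset.sum_congr rfl fun i _ => by ring
      _ ≤ 2 ^ n * Real.exp ((t / B) ^ 2 / 2 * B) := by gcongr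
      _ = _ := by
          rw [mul_comm]
          congr 2
          field_simp
  have h2 : Real.exp (t ^ 2 / (2 * B)) = Real.exp (-(t ^ 2 / (2 * B))) * Real.exp (t / B * t) := by
    rw [← Real.exp_add]
    congr 1
    field_simp
    ring
  rw [h2, mul_right_comm] at h1
  exact le_of_mul_le_mul_right h1 (Real.exp_pos _)

/-- Hoeffding's inequality for sums with random signs. -/
theorem card_lt_abs_signedSum {n : ℕ} (v : Fin n → ℝ) {B t : ℝ} (hB : 0 < B)
    (hv : ∑ i, v i ^ 2 ≤ B) (ht : 0 ≤ t) :
    ((Finset.univ.filter fun σ : Fin n → Bool => t < |signedSum σ v|).card : ℝ)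
      ≤ 2 * Real.exp (-(t ^ 2 / (2 * B))) * 2 ^ n := by
  have hsub : (Finset.univ.filter fun σ : Fin n → Bool => t < |signedSum σ v|)
      ⊆ (Finset.univ.filter fun σ : Fin n → Bool => t < signedSum σ v)
        ∪ Finset.univ.filter fun σ : Fin n → Bool => t < signedSum σ (-v) := by
    intro σ
    simp [signedSum_neg, lt_abs]
  have h1 := card_lt_signedSum v hB hv ht
  have h2 := card_lt_signedSum (-v) hB (by simpa using hv) ht
  have h3 := (Finset.card_le_card hsub).trans (Finset.card_union_le _ _)
  have h4 : ((Finset.univ.filter fun σ : Fin n → Bool => t < |signedSum σ v|).card : ℝ)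
      ≤ ((Finset.univ.filter fun σ : Fin n → Bool => t < signedSum σ v).card : ℝ)
        + ((Finset.univ.filter fun σ : Fin n → Bool => t < signedSum σ (-v)).card : ℝ) := by
    exact_mod_cast h3
  linarith

/-- The differences of the values of `g` at the two halves of a double sample. -/
def halfDiff {Z : Type*} {n : ℕ} (w : Fin n ⊕ Fin n → Z) (g : Z → ℝ) : Fin n → ℝ :=
  fun i => g (w (.inl i)) - g (w (.inr i))

theorem sum_abs_halfDiff_sub_le {Z : Type*} {n : ℕ} (w : Fin n ⊕ Fin n → Z) (g g' : Z → ℝ) :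
    ∑ i, |(halfDiff w g - halfDiff w g') i| ≤ ∑ j, |g (w j) - g' (w j)| := by
  rw [Fintype.sum_sum_type, ← Finset.sum_add_distrib]
  refine Finset.sum_le_sum fun i _ => ?_
  simp only [Pi.sub_apply, halfDiff]
  refine le_trans (le_of_eq ?_) (abs_sub _ _)
  congr 1; ring

/-- Differences of [0, 1]-valued functions have squares below their absolute values, so L¹ nets
control the variance proxy in Hoeffding's inequality. -/
theorem sum_sq_halfDiff_sub_le {Z : Type*} {n : ℕ} (w : Fin n ⊕ Fin n → Z) {g g' : Z → ℝ}
    (hg : ∀ z, g z ∈ Set.Icc (0 : ℝ) 1) (hg' : ∀ z, g' z ∈ Set.Icc (0 : ℝ) 1) :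
    ∑ i, ((halfDiff w g - halfDiff w g') i) ^ 2 ≤ 2 * ∑ j, |g (w j) - g' (w j)| := by
  rw [Fintype.sum_sum_type, ← Finset.sum_add_distrib, Finset.mul_sum]
  refine Finset.sum_le_sum fun i _ => ?_
  have hsq : ∀ z, (g z - g' z) ^ 2 ≤ |g z - g' z| := by
    intro z
    have h1 : |g z - g' z| ≤ 1 := by
      rw [abs_le]; constructor <;> linarith [(hg z).1, (hg z).2, (hg' z).1, (hg' z).2]
    rw [← sq_abs]
    nlinarith [abs_nonneg (g z - g' z)]
  simp only [Pi.sub_apply, halfDiff]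
  nlinarith [hsq (w (.inl i)), hsq (w (.inr i)),
    sq_nonneg ((g (w (.inl i)) - g' (w (.inl i))) + (g (w (.inr i)) - g' (w (.inr i))))]

/-- Deterministic half of chaining: telescoping along the nets, the base contributes nε/8, the links
at most nε/8 because ∑ (k+1)2^{-k} ≤ 4, and the remainder beyond level `M` at most nε/4. -/
theorem chaining_bound {Z : Type*} {n : ℕ} (w : Fin n ⊕ Fin n → Z) {𝒢 : Set (Z → ℝ)}
    (S : ℕ → Finset (Z → ℝ))
    (hnet : ∀ k, ∀ g ∈ 𝒢, ∃ g' ∈ S k,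
      ∑ j, |g (w j) - g' (w j)| ≤ (1 / 4) ^ k * (2 * n)) {ε : ℝ} (M : ℕ)
    (hM : (1 / 4) ^ M ≤ ε / 8) (σ : Fin n → Bool)
    (hbase : ∀ a ∈ S 0, |signedSum σ (halfDiff w a)| ≤ n * ε / 8)
    (hlink : ∀ k < M, ∀ a ∈ S (k + 1), ∀ b ∈ S k,
      ∑ j, |a (w j) - b (w j)| ≤ 5 / 4 * (1 / 4) ^ k * (2 * n) →
      |signedSum σ (halfDiff w a - halfDiff w b)| ≤ n * ε / 32 * ((k + 1) * (1 / 2) ^ k))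
    {g : Z → ℝ} (hg : g ∈ 𝒢) :
    |signedSum σ (halfDiff w g)| ≤ n * ε / 2 := by
  choose π hπS hπ using fun k => hnet k g hg
  have hε : 0 ≤ ε := by
    have : (0 : ℝ) ≤ (1 / 4) ^ M := by positivity
    linarith
  have hsum : ∀ k : ℕ, ∑ j ∈ Finset.range k, (((j : ℝ) + 1) * (1 / 2) ^ j)
      = 4 - (2 * k + 4) * (1 / 2) ^ k := by
    intro k
    induction k with
    | zero => norm_num
    | succ k ih => rw [Finset.sum_range_succ, ih, pow_succ]; push_cast; ring
  have hk : ∀ k ≤ M, |signedSum σ (halfDiff w (π k))|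
      ≤ n * ε / 8 + n * ε / 32 * ∑ j ∈ Finset.range k, (((j : ℝ) + 1) * (1 / 2) ^ j) := by
    intro k
    induction k with
    | zero => intro _; simpa using hbase _ (hπS 0)
    | succ k ih =>
      intro hkM
      have h1 := hlink k (by omega) _ (hπS (k + 1)) _ (hπS k) (by
        calc ∑ j, |π (k + 1) (w j) - π k (w j)|
            ≤ ∑ j, (|g (w j) - π (k + 1) (w j)| + |g (w j) - π k (w j)|) := by
              refine Finset.sum_le_sum fun j _ => ?_
              rw [abs_sub_comm (g (w j)) (π (k + 1) (w j))]
              exact abs_sub_le _ _ _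
          _ ≤ (1 / 4) ^ (k + 1) * (2 * n) + (1 / 4) ^ k * (2 * n) := by
              rw [Finset.sum_add_distrib]
              exact add_le_add (hπ _) (hπ _)
          _ = _ := by rw [pow_succ]; ring)
      rw [signedSum_sub] at h1
      have h2 := abs_sub_abs_le_abs_sub (signedSum σ (halfDiff w (π (k + 1))))
        (signedSum σ (halfDiff w (π k)))
      rw [Finset.sum_range_succ, mul_add]
      linarith [ih (by omega)]
  have h1 := hk M le_rfl
  rw [hsum] at h1
  have h2 : |signedSum σ (halfDiff w g) - signedSum σ (halfDiff w (π M))| ≤ n * ε / 4 := by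
    rw [← signedSum_sub]
    refine (abs_signedSum_le _ _).trans ((sum_abs_halfDiff_sub_le _ _ _).trans ((hπ M).trans ?_))
    calc (1 / 4) ^ M * (2 * (n : ℝ)) ≤ ε / 8 * (2 * n) := by gcongr
      _ = _ := by ring
  have h3 := abs_sub_abs_le_abs_sub (signedSum σ (halfDiff w g)) (signedSum σ (halfDiff w (π M)))
  have h4 : 0 ≤ n * ε / 32 * ((2 * M + 4) * (1 / 2) ^ M) := by positivity
  nlinarith

theorem covering_constant_le (k : ℕ) :
    144 / (((1 : ℝ) / 4) ^ k) ^ 2 ≤ Real.exp (5 + 3 * k) := by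
  have he : (2.718 : ℝ) ≤ Real.exp 1 := by linarith [Real.exp_one_gt_d9]
  have h144 : (144 : ℝ) ≤ Real.exp 5 := by
    calc (144 : ℝ) ≤ 2.718 ^ 5 := by norm_num
      _ ≤ Real.exp 1 ^ 5 := by gcongr
      _ = Real.exp 5 := by rw [← Real.exp_nat_mul]; norm_num
  have h16 : (16 : ℝ) ≤ Real.exp 3 := by
    calc (16 : ℝ) ≤ 2.718 ^ 3 := by norm_num
      _ ≤ Real.exp 1 ^ 3 := by gcongr
      _ = Real.exp 3 := by rw [← Real.exp_nat_mul]; norm_num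
  have heq : 144 / (((1 : ℝ) / 4) ^ k) ^ 2 = 144 * 16 ^ k := by
    rw [div_pow, one_pow, div_pow, one_pow, ← pow_mul, mul_comm k 2, pow_mul]
    norm_num
  rw [heq, Real.exp_add, mul_comm (3 : ℝ), Real.exp_nat_mul]
  gcongr

open Classical in
/-- For a class of `[0, 1]`-valued functions of pseudo-dimension at most `P`, only few choices of
signs produce a large signed sum for some member of the class. -/
theorem card_exists_lt_abs_signedSum {Z : Type*} {n : ℕ} (hn0 : 0 < n) (w : Fin n ⊕ Fin n → Z)
    {𝒢 : Set (Z → ℝ)} {P : ℕ} (hP1 : 1 ≤ P) (hP : ∀ s : Finset Z, PShatters 𝒢 s → s.card ≤ P)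
    (h01 : ∀ g ∈ 𝒢, ∀ z, g z ∈ Set.Icc (0 : ℝ) 1) {ε δ : ℝ} (hε : 0 < ε) (hδ : 0 < δ)
    (hδ1 : δ ≤ 1) (hn : 163840 * (P + Real.log (2 / δ)) ≤ n * ε ^ 2) :
    ((Finset.univ.filter fun σ : Fin n → Bool =>
        ∃ g ∈ 𝒢, n * ε / 2 < |signedSum σ (halfDiff w g)|).card : ℝ) ≤ δ / 2 * 2 ^ n := by
  have : Nonempty (Fin n) := ⟨⟨0, hn0⟩⟩
  have hnR : (0 : ℝ) < n := by exact_mod_cast hn0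
  have hcardι : (Fintype.card (Fin n ⊕ Fin n) : ℝ) = 2 * n := by simp; ring
  choose S hS𝒢 hScard hSnet using fun k : ℕ => exists_net w hP1 hP h01
    (τ := (1 / 4) ^ k) (by positivity) (pow_le_one₀ (by norm_num) (by norm_num))
  simp only [hcardι] at hSnet
  obtain ⟨M, hM⟩ : ∃ M : ℕ, ((1 : ℝ) / 4) ^ M ≤ ε / 8 := by
    obtain ⟨M, hM⟩ := exists_pow_lt_of_lt_one (show (0 : ℝ) < ε / 8 by positivity)
      (show (1 : ℝ) / 4 < 1 by norm_num)
    exact ⟨M, hM.le⟩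
  set L := Real.log (2 / δ) with hL
  set x := Real.exp (-L) with hx
  have hxδ : x = δ / 2 := by
    rw [hx, hL, ← Real.log_inv, Real.exp_log (by positivity), inv_div]
  have hx0 : 0 < x := Real.exp_pos _
  have hx12 : x ≤ 1 / 2 := by rw [hxδ]; linarith
  have hL0 : 0 ≤ L := Real.log_nonneg (by rw [le_div_iff₀ hδ]; linarith)
  have hPR : (0 : ℝ) ≤ P := Nat.cast_nonneg _
  have hcov : ∀ k : ℕ, ((S k).card : ℝ) ≤ Real.exp (P * (5 + 3 * k)) := by
    intro k
    refine (hScard k).trans ?_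
    rw [Real.exp_nat_mul]
    exact pow_le_pow_left₀ (by positivity) (covering_constant_le k) P
  let A : (Fin n → ℝ) → ℝ → Finset (Fin n → Bool) := fun v t =>
    Finset.univ.filter fun σ => t < |signedSum σ v|
  let t : ℕ → ℝ := fun k => n * ε / 32 * ((k + 1) * (1 / 2) ^ k)
  let D : ℕ → Finset ((Z → ℝ) × (Z → ℝ)) := fun k => (S (k + 1) ×ˢ S k).filter fun p =>
    ∑ j, |p.1 (w j) - p.2 (w j)| ≤ 5 / 4 * (1 / 4) ^ k * (2 * n)
  have hsub : (Finset.univ.filter fun σ : Fin n → Bool =>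
        ∃ g ∈ 𝒢, n * ε / 2 < |signedSum σ (halfDiff w g)|)
      ⊆ ((S 0).biUnion fun a => A (halfDiff w a) (n * ε / 8))
        ∪ (Finset.range M).biUnion fun k => (D k).biUnion fun p =>
            A (halfDiff w p.1 - halfDiff w p.2) (t k) := by
    intro σ hσ
    obtain ⟨g, hg, hgt⟩ := (Finset.mem_filter.1 hσ).2
    by_contra hnot
    simp only [Finset.mem_union, Finset.mem_biUnion, not_or, not_exists, not_and, A,
      Finset.mem_filter, Finset.mem_univ, true_and, not_lt, Finset.mem_range, D,
      Finset.mem_product] at hnot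
    refine absurd (chaining_bound w S hSnet M hM σ hnot.1 ?_ hg) (not_le.2 hgt)
    intro k hk a ha b hb hab
    exact hnot.2 k hk (a, b) ⟨⟨ha, hb⟩, hab⟩
  have hbase : ∀ a ∈ S 0, ((A (halfDiff w a) (n * ε / 8)).card : ℝ)
      ≤ 2 * Real.exp (-(n * ε ^ 2 / 128)) * 2 ^ n := by
    intro a ha
    have h := card_lt_abs_signedSum (halfDiff w a) (B := n) (t := n * ε / 8) hnR (by
      calc ∑ i, halfDiff w a i ^ 2 ≤ ∑ i : Fin n, (1 : ℝ) := by
            refine Finset.sum_le_sum fun i _ => ?_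
            have h1 := h01 a (hS𝒢 0 ha) (w (.inl i))
            have h2 := h01 a (hS𝒢 0 ha) (w (.inr i))
            rw [sq_le_one_iff_abs_le_one, abs_le, halfDiff]
            constructor <;> linarith [h1.1, h1.2, h2.1, h2.2]
        _ = n := by simp) (by positivity)
    refine h.trans (le_of_eq ?_)
    congr 4
    field_simp
    norm_num
  -- The variance proxy 5n·4^{-k} is twice the link length; the factor 4^{-k} cancels in t²/(2B),
  -- leaving (k+1)² and the constant 10240 = 32²·10.
  have hlink : ∀ k, ∀ p ∈ D k, ((A (halfDiff w p.1 - halfDiff w p.2) (t k)).card : ℝ)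
      ≤ 2 * Real.exp (-(n * ε ^ 2 / 10240 * (k + 1) ^ 2)) * 2 ^ n := by
    intro k p hp
    simp only [D, Finset.mem_filter, Finset.mem_product] at hp
    have h := card_lt_abs_signedSum (halfDiff w p.1 - halfDiff w p.2)
      (B := 5 * n * (1 / 4) ^ k) (t := t k) (by positivity) (by
        have := sum_sq_halfDiff_sub_le w (h01 _ (hS𝒢 _ hp.1.1)) (h01 _ (hS𝒢 _ hp.1.2))
        linarith [hp.2]) (by positivity)
    refine h.trans (le_of_eq ?_)
    congr 4
    have h4 : ((1 : ℝ) / 4) ^ k = ((1 / 2) ^ k) ^ 2 := by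
      rw [← pow_mul, mul_comm, pow_mul]; norm_num
    have h5 : ((1 : ℝ) / 2) ^ k ≠ 0 := by positivity
    simp only [t, h4]
    field_simp
    norm_num
  have hbaseT : ∑ a ∈ S 0, ((A (halfDiff w a) (n * ε / 8)).card : ℝ) ≤ x / 2 * 2 ^ n := by
    calc _ ≤ ∑ a ∈ S 0, 2 * Real.exp (-(n * ε ^ 2 / 128)) * 2 ^ n := Finset.sum_le_sum hbase
      _ = (S 0).card * (2 * Real.exp (-(n * ε ^ 2 / 128)) * 2 ^ n) := by simp
      _ ≤ Real.exp (P * (5 + 3 * (0 : ℕ))) * (2 * Real.exp (-(n * ε ^ 2 / 128)) * 2 ^ n) := by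
          gcongr
          exact hcov 0
      _ = 2 * Real.exp (P * 5 - n * ε ^ 2 / 128) * 2 ^ n := by
          rw [sub_eq_add_neg, Real.exp_add]; push_cast; ring_nf
      _ ≤ 2 * Real.exp ((3 : ℕ) * -L) * 2 ^ n := by
          gcongr
          push_cast
          linarith
      _ = 2 * x ^ 3 * 2 ^ n := by rw [Real.exp_nat_mul]
      _ ≤ _ := by
          gcongr
          nlinarith [mul_pos hx0 hx0]
  have hlinkT : ∀ k, ∑ p ∈ D k, ((A (halfDiff w p.1 - halfDiff w p.2) (t k)).card : ℝ)
      ≤ x / 4 * (1 / 2) ^ k * 2 ^ n := by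
    intro k
    have hkR : (0 : ℝ) ≤ k := Nat.cast_nonneg _
    have hDcard : ((D k).card : ℝ) ≤ Real.exp (16 * P * (k + 1)) := by
      calc ((D k).card : ℝ) ≤ (S (k + 1)).card * (S k).card := by
            rw [← Nat.cast_mul, ← Finset.card_product]
            exact_mod_cast Finset.card_filter_le _ _
        _ ≤ Real.exp (P * (5 + 3 * (k + 1 : ℕ))) * Real.exp (P * (5 + 3 * k)) := by
            gcongr
            · exact hcov _
            · exact hcov _
        _ ≤ _ := by
            rw [← Real.exp_add]
            gcongr
            push_cast
            nlinarith [mul_nonneg hPR hkR]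
    calc _ ≤ ∑ p ∈ D k, 2 * Real.exp (-(n * ε ^ 2 / 10240 * (k + 1) ^ 2)) * 2 ^ n :=
          Finset.sum_le_sum (hlink k)
      _ = (D k).card * (2 * Real.exp (-(n * ε ^ 2 / 10240 * (k + 1) ^ 2)) * 2 ^ n) := by simp
      _ ≤ Real.exp (16 * P * (k + 1))
            * (2 * Real.exp (-(n * ε ^ 2 / 10240 * (k + 1) ^ 2)) * 2 ^ n) := by gcongr
      _ = 2 * Real.exp (16 * P * (k + 1) - n * ε ^ 2 / 10240 * (k + 1) ^ 2) * 2 ^ n := by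
          rw [sub_eq_add_neg, Real.exp_add]; ring
      -- Here 163840 = 16·10240 makes the Hoeffding exponent at least 16(P + L)(k+1)², which absorbs
      -- the entropy 16P(k+1) and leaves at least (k+4)L. Since e^{-L} = δ/2 ≤ 1/2, the spare powers
      -- give a geometric series in k.
      _ ≤ 2 * Real.exp ((k + 4 : ℕ) * -L) * 2 ^ n := by
          gcongr
          push_cast
          have h1 : 16 * (P + L) ≤ n * ε ^ 2 / 10240 := by linarith
          have h2 : 16 * (P + L) * (k + 1) ^ 2 ≤ n * ε ^ 2 / 10240 * (k + 1) ^ 2 := by gcongr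
          nlinarith [mul_nonneg hPR hkR, mul_nonneg hL0 hkR, mul_nonneg hPR (sq_nonneg (k : ℝ)),
            mul_nonneg hL0 (sq_nonneg (k : ℝ))]
      _ = 2 * (x * x ^ (k + 3)) * 2 ^ n := by rw [Real.exp_nat_mul, ← pow_succ']
      _ ≤ 2 * (x * (1 / 2) ^ (k + 3)) * 2 ^ n := by gcongr
      _ = _ := by rw [pow_add]; ring
  have hgeo : ∑ k ∈ Finset.range M, ((1 : ℝ) / 2) ^ k ≤ 2 := by
    have := (geom_sum_eq (show (1 : ℝ) / 2 ≠ 1 by norm_num) M)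
    rw [this, div_le_iff_of_neg (by norm_num)]
    have : (0 : ℝ) < (1 / 2) ^ M := by positivity
    linarith
  have hcard : ((Finset.univ.filter fun σ : Fin n → Bool =>
        ∃ g ∈ 𝒢, n * ε / 2 < |signedSum σ (halfDiff w g)|).card : ℝ)
      ≤ ∑ a ∈ S 0, ((A (halfDiff w a) (n * ε / 8)).card : ℝ)
        + ∑ k ∈ Finset.range M, ∑ p ∈ D k,
            ((A (halfDiff w p.1 - halfDiff w p.2) (t k)).card : ℝ) := by
    have h1 := (Finset.card_le_card hsub).trans (Finset.card_union_le _ _)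
    have h2 := Finset.card_biUnion_le (s := S 0) (t := fun a => A (halfDiff w a) (n * ε / 8))
    have h3 := (Finset.card_biUnion_le (s := Finset.range M)
      (t := fun k => (D k).biUnion fun p => A (halfDiff w p.1 - halfDiff w p.2) (t k))).trans
      (Finset.sum_le_sum fun k _ => Finset.card_biUnion_le)
    exact_mod_cast h1.trans (add_le_add h2 h3)
  refine hcard.trans ?_
  calc _ ≤ x / 2 * 2 ^ n + ∑ k ∈ Finset.range M, x / 4 * (1 / 2) ^ k * 2 ^ n :=
        add_le_add hbaseT (Finset.sum_le_sum fun k _ => hlinkT k)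
    _ = x / 2 * 2 ^ n + x / 4 * (∑ k ∈ Finset.range M, (1 / 2) ^ k) * 2 ^ n := by
        rw [Finset.mul_sum, Finset.sum_mul]
    _ ≤ x / 2 * 2 ^ n + x / 4 * 2 * 2 ^ n := by gcongr
    _ = δ / 2 * 2 ^ n := by rw [hxδ]; ring

/-! ### Symmetrization -/

section Symmetrization

variable {Z : Type*} [MeasurableSpace Z] {μ : Measure Z} [IsProbabilityMeasure μ]

theorem measurePreserving_comp_equiv {ι ι' : Type*} [Fintype ι] [Fintype ι'] (e : ι ≃ ι') :
    MeasurePreserving (fun W : ι' → Z => W ∘ e) (Measure.pi fun _ => μ)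
      (Measure.pi fun _ => μ) :=
  (measurePreserving_piCongrLeft (fun _ : ι' => μ) e).symm

theorem IsMeasurableClass.aemeasurable_iSup {𝒢 : Set (Z → ℝ)} (h : IsMeasurableClass μ 𝒢)
    {ι : Type*} [Fintype ι] (a : ι → ℝ) :
    AEMeasurable (fun W : ι → Z => ⨆ g : 𝒢, |∑ j, a j * (g : Z → ℝ) (W j)|)
      (Measure.pi fun _ => μ) := by
  let e := (Fintype.equivFin ι).symm
  have h1 := (h.2 _ (a ∘ e)).comp_quasiMeasurePreserving
    (measurePreserving_comp_equiv (μ := μ) e).quasiMeasurePreserving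
  refine h1.congr (Filter.Eventually.of_forall fun W => ?_)
  simp only [Function.comp_apply]
  congr 1
  funext g
  rw [e.sum_comp fun j => a j * (g : Z → ℝ) (W j)]

/-- The double samples on which some member of `𝒢` has a large signed sum of differences. -/
def largeDiff {Z : Type*} {n : ℕ} (𝒢 : Set (Z → ℝ)) (t : ℝ) (σ : Fin n → Bool) :
    Set (Fin n ⊕ Fin n → Z) :=
  {W | ∃ g ∈ 𝒢, t < |signedSum σ (halfDiff W g)|}

theorem nullMeasurableSet_largeDiff {𝒢 : Set (Z → ℝ)} (h𝒢 : IsMeasurableClass μ 𝒢) {H : ℝ}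
    (h0H : ∀ g ∈ 𝒢, ∀ z, g z ∈ Set.Icc (0 : ℝ) H) {n : ℕ} (t : ℝ) (σ : Fin n → Bool) :
    NullMeasurableSet (largeDiff 𝒢 t σ) (Measure.pi fun _ : Fin n ⊕ Fin n => μ) := by
  rcases 𝒢.eq_empty_or_nonempty with rfl | hne
  · simp [largeDiff]
  have : Nonempty 𝒢 := hne.to_subtype
  let a : Fin n ⊕ Fin n → ℝ :=
    Sum.elim (fun i => if σ i then 1 else -1) fun i => -(if σ i then 1 else -1)
  have hsum : ∀ (W : Fin n ⊕ Fin n → Z) (g : Z → ℝ),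
      signedSum σ (halfDiff W g) = ∑ j, a j * g (W j) := by
    intro W g
    rw [Fintype.sum_sum_type, ← Finset.sum_add_distrib]
    refine Finset.sum_congr rfl fun i _ => ?_
    simp only [a, halfDiff, Sum.elim_inl, Sum.elim_inr]
    ring
  have hset : largeDiff 𝒢 t σ
      = {W : Fin n ⊕ Fin n → Z | t < ⨆ g : 𝒢, |∑ j, a j * (g : Z → ℝ) (W j)|} := by
    ext W
    have hbdd : BddAbove (Set.range fun g : 𝒢 => |∑ j, a j * (g : Z → ℝ) (W j)|) := by
      refine ⟨∑ j, |a j| * H, ?_⟩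
      rintro _ ⟨g, rfl⟩
      refine (Finset.abs_sum_le_sum_abs _ _).trans (Finset.sum_le_sum fun j _ => ?_)
      rw [abs_mul, abs_of_nonneg (h0H g g.2 (W j)).1]
      exact mul_le_mul_of_nonneg_left (h0H g g.2 (W j)).2 (abs_nonneg _)
    simp only [Set.mem_ofPred_eq, largeDiff]
    rw [lt_ciSup_iff hbdd]
    simp [hsum]
  rw [hset]
  exact nullMeasurableSet_lt aemeasurable_const (h𝒢.aemeasurable_iSup a)

/-- The permutation of a double sample that exchanges the two copies of the `i`-th point whenever
`σ i` is `false`. -/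
def swapHalves {n : ℕ} (σ : Fin n → Bool) : Equiv.Perm (Fin n ⊕ Fin n) :=
  Function.Involutive.toPerm
    (Sum.elim (fun i => if σ i then .inl i else .inr i) fun i => if σ i then .inr i else .inl i)
    (by rintro (i | i) <;> cases h : σ i <;> simp [h])

theorem swapHalves_inl {n : ℕ} (σ : Fin n → Bool) (i : Fin n) :
    swapHalves σ (.inl i) = if σ i then .inl i else .inr i := rfl

theorem swapHalves_inr {n : ℕ} (σ : Fin n → Bool) (i : Fin n) :
    swapHalves σ (.inr i) = if σ i then .inr i else .inl i := rfl

/-- A sign `false` amounts to exchanging two i.i.d. coordinates, which preserves the product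
measure. -/
theorem measure_largeDiff_eq {𝒢 : Set (Z → ℝ)} (h𝒢 : IsMeasurableClass μ 𝒢) {H : ℝ}
    (h0H : ∀ g ∈ 𝒢, ∀ z, g z ∈ Set.Icc (0 : ℝ) H) {n : ℕ} (t : ℝ) (σ : Fin n → Bool) :
    Measure.pi (fun _ : Fin n ⊕ Fin n => μ) (largeDiff 𝒢 t σ)
      = Measure.pi (fun _ : Fin n ⊕ Fin n => μ) (largeDiff 𝒢 t fun _ => true) := by
  rw [← (measurePreserving_comp_equiv (swapHalves σ)).measure_preimage
    (nullMeasurableSet_largeDiff h𝒢 h0H t fun _ => true)]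
  congr 1
  ext W
  have : ∀ g : Z → ℝ, signedSum σ (halfDiff W g)
      = signedSum (fun _ => true) (halfDiff (W ∘ swapHalves σ) g) := by
    intro g
    refine Finset.sum_congr rfl fun i _ => ?_
    cases h : σ i <;> simp [halfDiff, swapHalves_inl, swapHalves_inr, h]
  simp [largeDiff, this]

open Classical in
-- All sign patterns give the same measure, so it equals its average over signs; exchanging sum and
-- integral reduces it to the count for a fixed double sample.
theorem measure_largeDiff_le {𝒢 : Set (Z → ℝ)} (h𝒢 : IsMeasurableClass μ 𝒢) {H : ℝ}
    (h0H : ∀ g ∈ 𝒢, ∀ z, g z ∈ Set.Icc (0 : ℝ) H) {n : ℕ} {t η : ℝ}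
    (hη : ∀ w : Fin n ⊕ Fin n → Z, ((Finset.univ.filter fun σ : Fin n → Bool =>
      ∃ g ∈ 𝒢, t < |signedSum σ (halfDiff w g)|).card : ℝ) ≤ η * 2 ^ n) :
    Measure.pi (fun _ : Fin n ⊕ Fin n => μ) (largeDiff 𝒢 t fun _ : Fin n => true)
      ≤ ENNReal.ofReal η := by
  set ρ := Measure.pi fun _ : Fin n ⊕ Fin n => μ
  have hnm := fun σ : Fin n → Bool => nullMeasurableSet_largeDiff h𝒢 h0H t σ
  have h1 : (2 : ENNReal) ^ n * ρ (largeDiff 𝒢 t fun _ : Fin n => true)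
      ≤ 2 ^ n * ENNReal.ofReal η := by
    calc (2 : ENNReal) ^ n * ρ (largeDiff 𝒢 t fun _ : Fin n => true)
        = ∑ σ : Fin n → Bool, ρ (largeDiff 𝒢 t σ) := by
          rw [Finset.sum_congr rfl fun σ _ => measure_largeDiff_eq h𝒢 h0H t σ]
          simp [ρ]
      _ = ∑ σ : Fin n → Bool, ∫⁻ W, (largeDiff 𝒢 t σ).indicator (fun _ => 1) W ∂ρ := by
          refine Finset.sum_congr rfl fun σ _ => ?_
          rw [lintegral_indicator_const₀ (hnm σ), one_mul]
      _ = ∫⁻ W, ∑ σ : Fin n → Bool, (largeDiff 𝒢 t σ).indicator (fun _ => 1) W ∂ρ :=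
          (lintegral_finsetSum' _ fun σ _ => aemeasurable_const.indicator₀ (hnm σ)).symm
      _ ≤ ∫⁻ _, 2 ^ n * ENNReal.ofReal η ∂ρ := by
          refine lintegral_mono fun W => ?_
          have h2 : ∑ σ : Fin n → Bool, (largeDiff 𝒢 t σ).indicator (fun _ => (1 : ENNReal)) W
              = ((Finset.univ.filter fun σ : Fin n → Bool =>
                ∃ g ∈ 𝒢, t < |signedSum σ (halfDiff W g)|).card : ENNReal) := by
            rw [Finset.card_filter]
            push_cast
            rfl
          rw [h2, ← ENNReal.ofReal_natCast]
          refine (ENNReal.ofReal_le_ofReal (hη W)).trans (le_of_eq ?_)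
          rw [mul_comm, ENNReal.ofReal_mul (by positivity), ENNReal.ofReal_pow (by norm_num)]
          simp
      _ = _ := by simp [ρ]
  exact (ENNReal.mul_le_mul_iff_right (by simp) (by simp)).1 h1

theorem measure_abs_sum_sub_ge_le_half {g : Z → ℝ} (hg : AEMeasurable g μ) {H : ℝ}
    (h0H : ∀ z, g z ∈ Set.Icc (0 : ℝ) H) {n : ℕ} (hn0 : 0 < n) {ε : ℝ} (hε : 0 < ε)
    (hn : 2 * H ^ 2 ≤ n * ε ^ 2) :
    Measure.pi (fun _ : Fin n => μ) {U | n * ε / 2 ≤ |∑ i, g (U i) - n * ∫ z, g z ∂μ|}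
      ≤ 1 / 2 := by
  have hnR : (0 : ℝ) < n := by exact_mod_cast hn0
  have hLp : MemLp g 2 μ := MemLp.of_bound hg.aestronglyMeasurable H
    (Filter.Eventually.of_forall fun z => by
      rw [Real.norm_eq_abs, abs_of_nonneg (h0H z).1]; exact (h0H z).2)
  have hcomp : ∀ i : Fin n, MemLp (fun U : Fin n → Z => g (U i)) 2 (Measure.pi fun _ => μ) :=
    fun i => hLp.comp_measurePreserving (measurePreserving_eval (fun _ : Fin n => μ) i)
  have hsumLp : MemLp (∑ i : Fin n, fun U : Fin n → Z => g (U i)) 2 (Measure.pi fun _ => μ) :=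
    memLp_finsetSum' _ fun i _ => hcomp i
  have hmean : ∫ U, (∑ i : Fin n, fun U : Fin n → Z => g (U i)) U ∂(Measure.pi fun _ => μ)
      = n * ∫ z, g z ∂μ := by
    simp only [Finset.sum_apply]
    rw [integral_finsetSum _ fun i _ => (hcomp i).integrable (by norm_num)]
    simp_rw [integral_comp_eval (μ := fun _ : Fin n => μ) hg.aestronglyMeasurable]
    simp
  have hvar := ProbabilityTheory.variance_sum_pi (μ := fun _ : Fin n => μ) (X := fun _ => g)
    fun _ => hLp
  have hcheb := ProbabilityTheory.meas_ge_le_variance_div_sq hsumLp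
    (c := n * ε / 2) (by positivity)
  rw [hmean, hvar] at hcheb
  simp only [Finset.sum_apply] at hcheb
  refine hcheb.trans ?_
  have hv := ProbabilityTheory.variance_le_sq_of_bounded (Filter.Eventually.of_forall h0H) hg
  rw [show (1 : ENNReal) / 2 = ENNReal.ofReal (1 / 2) by
    rw [ENNReal.ofReal_div_of_pos (by norm_num)]; simp]
  refine ENNReal.ofReal_le_ofReal ?_
  rw [div_le_iff₀ (by positivity)]
  simp only [Finset.sum_const, Finset.card_univ, Fintype.card_fin, nsmul_eq_mul]
  calc (n : ℝ) * ProbabilityTheory.variance g μ ≤ n * ((H - 0) / 2) ^ 2 := by gcongr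
    _ ≤ 1 / 2 * (n * ε / 2) ^ 2 := by nlinarith

open Classical in
/-- Symmetrization: the (outer) probability of a large uniform deviation is controlled by random
signs on a double sample. -/
theorem measure_exists_lt_abs_empiricalMean_sub_le {𝒢 : Set (Z → ℝ)}
    (h𝒢 : IsMeasurableClass μ 𝒢) {H : ℝ} (h0H : ∀ g ∈ 𝒢, ∀ z, g z ∈ Set.Icc (0 : ℝ) H)
    {n : ℕ} (hn0 : 0 < n) {ε η : ℝ} (hε : 0 < ε) (hn : 2 * H ^ 2 ≤ n * ε ^ 2)
    (hη : ∀ w : Fin n ⊕ Fin n → Z, ((Finset.univ.filter fun σ : Fin n → Bool =>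
      ∃ g ∈ 𝒢, n * ε / 2 < |signedSum σ (halfDiff w g)|).card : ℝ) ≤ η * 2 ^ n) :
    Measure.pi (fun _ : Fin n => μ)
      {U | ∃ g ∈ 𝒢, ε < |empiricalMean g U - ∫ z, g z ∂μ|} ≤ ENNReal.ofReal (2 * η) := by
  have hnR : (0 : ℝ) < n := by exact_mod_cast hn0
  set Q := Measure.pi fun _ : Fin n => μ with hQ
  set t := n * ε / 2 with ht
  set E : Set ((Fin n → Z) × (Fin n → Z)) :=
    (fun p => (Sum.elim p.1 p.2 : Fin n ⊕ Fin n → Z)) ⁻¹' largeDiff 𝒢 t fun _ => true with hE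
  have hEmeas : (Q.prod Q) E ≤ ENNReal.ofReal η := by
    have hmp : MeasurePreserving (fun p : (Fin n → Z) × (Fin n → Z) =>
        (Sum.elim p.1 p.2 : Fin n ⊕ Fin n → Z)) (Q.prod Q)
        (Measure.pi fun _ : Fin n ⊕ Fin n => μ) := by
      have h := measurePreserving_sumPiEquivProdPi_symm (fun _ : Fin n ⊕ Fin n => μ)
      have hfun : (fun p : (Fin n → Z) × (Fin n → Z) => (Sum.elim p.1 p.2 : Fin n ⊕ Fin n → Z))
          = (MeasurableEquiv.sumPiEquivProdPi fun _ : Fin n ⊕ Fin n => Z).symm := by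
        funext p j
        rcases j with j | j <;> rfl
      rw [hfun]
      exact h
    rw [hE, hmp.measure_preimage (nullMeasurableSet_largeDiff h𝒢 h0H t _)]
    exact measure_largeDiff_le h𝒢 h0H hη
  -- A measurable hull of the same measure has measurable section measures, as Markov's inequality
  -- needs; the bad set of `U` itself need not be measurable.
  set T := toMeasurable (Q.prod Q) E with hT
  have hTm : MeasurableSet T := measurableSet_toMeasurable _ _
  have hsub : {U | ∃ g ∈ 𝒢, ε < |empiricalMean g U - ∫ z, g z ∂μ|}
      ⊆ {U | (1 / 2 : ENNReal) ≤ Q (Prod.mk U ⁻¹' T)} := by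
    rintro U ⟨g, hg, hgU⟩
    have hhalf := measure_abs_sum_sub_ge_le_half (h𝒢.1 g hg) (h0H g hg) hn0 hε hn
    have hcover : Set.univ ⊆ Prod.mk U ⁻¹' T
        ∪ {U' : Fin n → Z | n * ε / 2 ≤ |∑ i, g (U' i) - n * ∫ z, g z ∂μ|} := by
      intro U' _
      by_cases hU' : n * ε / 2 ≤ |∑ i, g (U' i) - n * ∫ z, g z ∂μ|
      · exact Or.inr hU'
      · refine Or.inl (subset_toMeasurable _ _ ?_)
        refine ⟨g, hg, ?_⟩
        have hs : signedSum (fun _ => true) (halfDiff (Sum.elim U U') g)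
            = ∑ i, g (U i) - ∑ i, g (U' i) := by
          simp [signedSum, halfDiff]
        have hU : n * ε < |∑ i, g (U i) - n * ∫ z, g z ∂μ| := by
          have : ∑ i, g (U i) - n * ∫ z, g z ∂μ = n * (empiricalMean g U - ∫ z, g z ∂μ) := by
            rw [empiricalMean]; field_simp
          rw [this, abs_mul, abs_of_pos hnR]
          gcongr
        dsimp only
        rw [hs, ht]
        rw [not_le] at hU'
        have h3 := abs_sub_abs_le_abs_sub (∑ i, g (U i) - n * ∫ z, g z ∂μ)
          (∑ i, g (U' i) - n * ∫ z, g z ∂μ)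
        rw [sub_sub_sub_cancel_right] at h3
        linarith
    have h1 : (1 : ENNReal) ≤ Q (Prod.mk U ⁻¹' T) + 1 / 2 := by
      calc (1 : ENNReal) = Q Set.univ := by simp [hQ]
        _ ≤ _ := (measure_mono hcover).trans (measure_union_le _ _)
        _ ≤ _ := by gcongr
    have h2 := tsub_le_iff_right.2 h1
    rwa [one_div, ENNReal.one_sub_inv_two, ← one_div] at h2
  have hmarkov := mul_meas_ge_le_lintegral (μ := Q)
    (measurable_measure_prodMk_left (ν := Q) hTm) (1 / 2)
  rw [← Measure.prod_apply hTm, hT, measure_toMeasurable] at hmarkov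
  calc Q {U | ∃ g ∈ 𝒢, ε < |empiricalMean g U - ∫ z, g z ∂μ|}
      ≤ Q {U | (1 / 2 : ENNReal) ≤ Q (Prod.mk U ⁻¹' T)} := measure_mono hsub
    _ = 2 * (1 / 2 * Q {U | (1 / 2 : ENNReal) ≤ Q (Prod.mk U ⁻¹' T)}) := by
        rw [← mul_assoc, one_div, ENNReal.mul_inv_cancel (by simp) (by simp), one_mul]
    _ ≤ 2 * ENNReal.ofReal η := by
        gcongr
        exact hmarkov.trans hEmeas
    _ = ENNReal.ofReal (2 * η) := by
        rw [ENNReal.ofReal_mul (by norm_num)]; simp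

end Symmetrization

/-! ### Uniform deviations -/

theorem PShatters.of_smul {Z : Type*} {𝒢 : Set (Z → ℝ)} {c : ℝ} (hc : 0 < c) {s : Finset Z}
    (h : PShatters ((fun g => c • g) '' 𝒢) s) : PShatters 𝒢 s := by
  obtain ⟨γ, hγ⟩ := h
  refine ⟨fun z => γ z / c, fun T hT => ?_⟩
  obtain ⟨_, ⟨g, hg, rfl⟩, hgT⟩ := hγ T hT
  refine ⟨g, hg, fun z hz => ?_⟩
  rw [← hgT z hz, div_le_iff₀ hc, mul_comm (g z)]
  rfl

open Classical in
/-- A class of functions with values in `[0, H]` and pseudo-dimension at most `P` satisfies the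
uniform law of large numbers at the rate given by chaining. -/
theorem measure_uniform_deviation_le {Z : Type*} [MeasurableSpace Z] {μ : Measure Z}
    [IsProbabilityMeasure μ] {𝒢 : Set (Z → ℝ)} (h𝒢 : IsMeasurableClass μ 𝒢) {P : ℕ}
    (hP1 : 1 ≤ P) (hP : ∀ s : Finset Z, PShatters 𝒢 s → s.card ≤ P) {H : ℝ}
    (h0H : ∀ g ∈ 𝒢, ∀ z, g z ∈ Set.Icc (0 : ℝ) H) {ε δ : ℝ} (hε : 0 < ε) (hδ : 0 < δ)
    (hδ1 : δ ≤ 1) {n : ℕ} (hn : 163840 * (H ^ 2 * (P + Real.log (2 / δ))) ≤ n * ε ^ 2) :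
    Measure.pi (fun _ : Fin n => μ)
      {U | ∃ g ∈ 𝒢, ε < |empiricalMean g U - ∫ z, g z ∂μ|} ≤ ENNReal.ofReal δ := by
  -- Rescaling by 1/H requires H > 0; otherwise every member of the class vanishes.
  rcases le_or_gt H 0 with hH | hH
  · have : {U : Fin n → Z | ∃ g ∈ 𝒢, ε < |empiricalMean g U - ∫ z, g z ∂μ|} = ∅ := by
      refine Set.eq_empty_iff_forall_notMem.2 ?_
      rintro U ⟨g, hg, hgU⟩
      have h0 : ∀ z, g z = 0 := fun z => le_antisymm ((h0H g hg z).2.trans hH) (h0H g hg z).1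
      simp [empiricalMean, h0] at hgU
      linarith
    rw [this]
    simp
  have hlog : 0 ≤ Real.log (2 / δ) := Real.log_nonneg (by rw [le_div_iff₀ hδ]; linarith)
  have hPR : (1 : ℝ) ≤ P := by exact_mod_cast hP1
  have hH2 : 0 < H ^ 2 := by positivity
  have hge : H ^ 2 ≤ H ^ 2 * (P + Real.log (2 / δ)) := le_mul_of_one_le_right hH2.le (by linarith)
  have hn0 : 0 < n := by
    rcases Nat.eq_zero_or_pos n with rfl | h
    · simp only [Nat.cast_zero, zero_mul] at hn
      linarith
    · exact h
  have key := measure_exists_lt_abs_empiricalMean_sub_le h𝒢 h0H hn0 (η := δ / 2) hε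
    (by linarith) (by
      intro w
      have h := card_exists_lt_abs_signedSum hn0 w (𝒢 := (fun g => H⁻¹ • g) '' 𝒢) hP1
        (fun s hs => hP s (hs.of_smul (inv_pos.2 hH))) (by
          rintro _ ⟨g, hg, rfl⟩ z
          have := h0H g hg z
          simp only [Pi.smul_apply, smul_eq_mul]
          rw [inv_mul_eq_div]
          exact ⟨div_nonneg this.1 hH.le, (div_le_one hH).2 this.2⟩)
        (ε := ε / H) (by positivity) hδ hδ1 (by
          rw [div_pow, ← mul_div_assoc, le_div_iff₀ hH2]
          linarith)
      refine le_trans (Nat.cast_le.2 (Finset.card_le_card fun σ hσ => ?_)) h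
      obtain ⟨g, hg, hgt⟩ := (Finset.mem_filter.1 hσ).2
      refine Finset.mem_filter.2 ⟨Finset.mem_univ _, _, Set.mem_image_of_mem _ hg, ?_⟩
      have hd : halfDiff w (H⁻¹ • g) = H⁻¹ • halfDiff w g := by
        funext i
        simp [halfDiff, mul_sub]
      rw [hd, signedSum_smul, abs_mul, abs_of_pos (inv_pos.2 hH), inv_mul_eq_div,
        lt_div_iff₀ hH]
      refine lt_of_eq_of_lt ?_ hgt
      field_simp)
  rwa [mul_div_cancel₀ _ (two_ne_zero' ℝ)] at key

/-! ### The two classes of the model -/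

theorem PShatters.card_le {Z : Type*} {𝒢 : Set (Z → ℝ)} {P : ℕ} (h : PDim 𝒢 = P)
    {s : Finset Z} (hs : PShatters 𝒢 s) : s.card ≤ P := by
  have h1 : (s.card : ℕ∞) ≤ PDim 𝒢 :=
    le_iSup₂ (f := fun (s : Finset Z) (_ : PShatters 𝒢 s) => (s.card : ℕ∞)) s hs
  rw [h] at h1
  exact_mod_cast h1

theorem Shatters.card_le {Z : Type*} {F : Set (Z → ℝ)} {V : ℕ} (h : VCDim F = V)
    {s : Finset Z} (hs : Shatters F s) : s.card ≤ V := by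
  have h1 : (s.card : ℕ∞) ≤ VCDim F :=
    le_iSup₂ (f := fun (s : Finset Z) (_ : Shatters F s) => (s.card : ℕ∞)) s hs
  rw [h] at h1
  exact_mod_cast h1

section Model

variable {d : ℕ} {X : Set (Content d)} {C : Set ℝ} {e : Content d} {F : Set (Content d → ℝ)}

theorem filteredOn_mem_Icc (f : Content d → ℝ) (u : X × C) :
    filteredOn X C e f u ∈ Set.Icc (0 : ℝ) 1 := by
  unfold filteredOn
  split_ifs <;> simp

/-- The empty and full patterns force thresholds into (0, 1], so patterns are exactly filtering
labels of ideal points. Users with a common ideal point share labels, hence shattered users have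
distinct ideal points, and these are shattered by `F`. -/
theorem card_le_of_pShatters_filteredOn {V : ℕ} (hV : VCDim F = V) {s : Finset (X × C)}
    (hs : PShatters (filteredOn X C e '' F) s) : s.card ≤ V := by
  classical
  obtain ⟨γ, hγ⟩ := hs
  have hpat : ∀ T ⊆ s, ∃ f ∈ F, ∀ u ∈ s, γ u ≤ filteredOn X C e f u ↔ u ∈ T := by
    intro T hT
    obtain ⟨_, ⟨f, hf, rfl⟩, h⟩ := hγ T hT
    exact ⟨f, hf, h⟩
  have hpos : ∀ u ∈ s, 0 < γ u := by
    intro u hu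
    obtain ⟨f, -, hf⟩ := hpat ∅ (Finset.empty_subset _)
    have h1 : ¬ γ u ≤ filteredOn X C e f u := by simp [hf u hu]
    exact (filteredOn_mem_Icc f u).1.trans_lt (not_le.1 h1)
  have hle : ∀ u ∈ s, γ u ≤ 1 := by
    intro u hu
    obtain ⟨f, -, hf⟩ := hpat s subset_rfl
    exact ((hf u hu).2 hu).trans (filteredOn_mem_Icc f u).2
  have hiff : ∀ u ∈ s, ∀ f : Content d → ℝ,
      γ u ≤ filteredOn X C e f u ↔ 0 < f (idealPoint e u.1 u.2) := by
    intro u hu f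
    unfold filteredOn
    split_ifs with h
    · simp [h, hle u hu]
    · simp [h, hpos u hu]
  let ψ : X × C → Content d := fun u => idealPoint e u.1 u.2
  have hinj : Set.InjOn ψ s := by
    intro u hu u' hu' huu
    obtain ⟨f, -, hf⟩ := hpat {u} (by simpa using hu)
    have h1 := (hiff u hu f).1 ((hf u hu).2 (by simp))
    have h2 : 0 < f (ψ u') := huu ▸ h1
    have h3 := (hf u' hu').1 ((hiff u' hu' f).2 h2)
    exact (by simpa using h3 : u' = u).symm
  rw [← Finset.card_image_of_injOn hinj]
  refine Shatters.card_le hV fun T _ => ?_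
  obtain ⟨f, hf, h⟩ := hpat (s.filter fun u => ψ u ∈ T) (Finset.filter_subset _ _)
  refine ⟨f, hf, fun z hz => ?_⟩
  obtain ⟨u, hu, rfl⟩ := Finset.mem_image.1 hz
  have h1 := (hiff u hu f).symm.trans (h u hu)
  rw [Finset.mem_filter] at h1
  exact h1.trans (and_iff_right hu)

/-- The mitigation depends on the moderator only through its benign region. -/
theorem mitigationOn_congr {f f' : Content d → ℝ} (h : ∀ z, 0 < f z ↔ 0 < f' z) :
    mitigationOn X C e f = mitigationOn X C e f' := by
  have hle : ∀ z, f z ≤ 0 ↔ f' z ≤ 0 := fun z => by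
    rw [← not_lt, ← not_lt, h]
  have hu : utility e f = utility e f' := by
    funext x c z
    simp only [utility, hle]
  have hbest : IsBestResponse X e f = IsBestResponse X e f' := by
    funext x c z
    simp only [IsBestResponse, hu]
  have hresp : bestResponse X e f = bestResponse X e f' := by
    unfold bestResponse
    rw [hbest]
  funext u
  simp only [mitigationOn, mitigation, socialDistortion, hresp, hle]

/-- With VC dimension 0 all moderators share one benign region, so there is at most one mitigation
function. This extends the condition δ ≤ 1/2 to the case V = 0. -/
theorem pDim_mitigationOn_eq_zero (hV : VCDim F = (0 : ℕ)) :
    PDim (mitigationOn X C e '' F) = 0 := by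
  classical
  have hsame : ∀ f ∈ F, ∀ f' ∈ F, mitigationOn X C e f = mitigationOn X C e f' := by
    intro f hf f' hf'
    refine mitigationOn_congr fun z => ?_
    by_contra hne
    have hsh : ∃ a ∈ F, ∃ b ∈ F, 0 < a z ∧ ¬ 0 < b z := by
      by_cases h : 0 < f z
      · exact ⟨f, hf, f', hf', h, fun h' => hne (iff_of_true h h')⟩
      · refine ⟨f', hf', f, hf, ?_, h⟩
        by_contra h'
        exact hne (iff_of_false h h')
    obtain ⟨a, ha, b, hb, haz, hbz⟩ := hsh
    have := Shatters.card_le (s := {z}) hV (by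
      intro T hT
      rcases Finset.subset_singleton_iff.1 hT with rfl | rfl
      · exact ⟨b, hb, by simpa using hbz⟩
      · exact ⟨a, ha, by simpa using haz⟩)
    simp at this
  refine le_antisymm (iSup₂_le fun s hs => ?_) (zero_le)
  obtain ⟨γ, hγ⟩ := hs
  obtain ⟨_, ⟨f, hf, rfl⟩, h1⟩ := hγ ∅ (Finset.empty_subset _)
  obtain ⟨_, ⟨f', hf', rfl⟩, h2⟩ := hγ s subset_rfl
  rw [hsame f hf f' hf'] at h1
  have : s = ∅ := Finset.eq_empty_of_forall_notMem fun u hu => by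
    simpa using (h1 u hu).1 ((h2 u hu).2 hu)
  simp [this]

end Model

/-- Absorbs the padding of the dimension to at least 1 and the constant 2 log 2 from splitting δ.
When `D = 0` only log(1/δ) ≥ log 2 is available to do so. -/
theorem dim_add_log_le {D : ℕ} {δ : ℝ} (hδ : 0 < δ) (hδ1 : δ < 1) (hD : D = 0 → δ ≤ 1 / 2) :
    ((D + 1 : ℕ) : ℝ) + Real.log (2 / (δ / 2)) ≤ 5 * (D + Real.log (1 / δ)) := by
  have h2 := Real.log_two_gt_d9
  have h2' := Real.log_two_lt_d9
  have hlog : Real.log (2 / (δ / 2)) = 2 * Real.log 2 + Real.log (1 / δ) := by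
    rw [show (2 : ℝ) / (δ / 2) = 2 * (2 * (1 / δ)) by field_simp,
      Real.log_mul (by norm_num) (by positivity), Real.log_mul (by norm_num) (by positivity)]
    ring
  have hpos : 0 ≤ Real.log (1 / δ) := Real.log_nonneg (by rw [le_div_iff₀ hδ]; linarith)
  rw [hlog]
  rcases Nat.eq_zero_or_pos D with rfl | hD1
  · have : Real.log 2 ≤ Real.log (1 / δ) := Real.log_le_log (by norm_num) (by
      rw [le_div_iff₀ hδ]
      linarith [hD rfl])
    push_cast
    linarith
  · have : (1 : ℝ) ≤ D := by exact_mod_cast hD1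
    push_cast
    linarith

end StrategicFiltering

open StrategicFiltering in
theorem mainTheorem1 :
    ∃ K : ℝ, 0 < K ∧
      ∀ (d : ℕ) (X : Set (Content d)) (C : Set ℝ) (e : Content d),
        Convex ℝ X → IsCompact X → C ⊆ Set.Ioi 0 →
      ∀ (F : Set (Content d → ℝ)) (H : ℝ),
        (∀ f ∈ F, ∀ u : X × C, mitigationOn X C e f u ∈ Set.Icc 0 H) →
      ∀ (P V : ℕ), PDim (mitigationOn X C e '' F) = P → VCDim F = V →
      ∀ (μ : MeasureTheory.Measure (X × C)) [MeasureTheory.IsProbabilityMeasure μ],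
        IsMeasurableClass μ (mitigationOn X C e '' F) →
        IsMeasurableClass μ (filteredOn X C e '' F) →
      ∀ (ε δ : ℝ), 0 < ε → 0 < δ → δ < 1 → (P = 0 → δ ≤ 1 / 2) →
      ∀ n : ℕ,
        K * (1 / ε ^ 2) * (H ^ 2 * P + max 1 (H ^ 2) * Real.log (1 / δ) + V) ≤ n →
        MeasureTheory.Measure.pi (fun _ : Fin n => μ)
          {U | ¬ ∀ f ∈ F,
            |empiricalMean (mitigationOn X C e f) U - ∫ u, mitigationOn X C e f u ∂μ| ≤ ε ∧
            |empiricalMean (filteredOn X C e f) U - ∫ u, filteredOn X C e f u ∂μ| ≤ ε}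
          ≤ ENNReal.ofReal δ := by
  -- The chaining constant times the factor 5 of `dim_add_log_le`.
  refine ⟨163840 * 5, by norm_num, ?_⟩
  intro d X C e _ _ _ F H hH P V hP hV μ _ hmit hfil ε δ hε hδ hδ1 hP0 n hn
  have hV0 : V = 0 → δ ≤ 1 / 2 := by
    rintro rfl
    refine hP0 ?_
    rw [pDim_mitigationOn_eq_zero hV] at hP
    exact_mod_cast hP.symm
  have hlog : 0 ≤ Real.log (1 / δ) := Real.log_nonneg (by rw [le_div_iff₀ hδ]; linarith)
  have hn' : 163840 * 5 * (H ^ 2 * P + max 1 (H ^ 2) * Real.log (1 / δ) + V) ≤ n * ε ^ 2 := by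
    rw [mul_one_div, div_mul_eq_mul_div, div_le_iff₀ (by positivity)] at hn
    exact hn
  have hmax1 : Real.log (1 / δ) ≤ max 1 (H ^ 2) * Real.log (1 / δ) :=
    le_mul_of_one_le_left hlog (le_max_left _ _)
  have hmax2 : H ^ 2 * Real.log (1 / δ) ≤ max 1 (H ^ 2) * Real.log (1 / δ) :=
    mul_le_mul_of_nonneg_right (le_max_right _ _) hlog
  have hPpos : 0 ≤ H ^ 2 * (P : ℝ) := by positivity
  have hVpos : (0 : ℝ) ≤ V := Nat.cast_nonneg _
  have h1 := measure_uniform_deviation_le (ε := ε) (δ := δ / 2) (n := n) hmit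
    (Nat.le_add_left 1 P) (fun s hs => (hs.card_le hP).trans (Nat.le_succ P)) (H := H)
    (by rintro _ ⟨f, hf, rfl⟩ u; exact hH f hf u) hε (by positivity) (by linarith) (by
      have := mul_le_mul_of_nonneg_left (dim_add_log_le hδ hδ1 hP0) (sq_nonneg H)
      linarith)
  have h2 := measure_uniform_deviation_le (ε := ε) (δ := δ / 2) (n := n) hfil
    (Nat.le_add_left 1 V)
    (fun s hs => (card_le_of_pShatters_filteredOn hV hs).trans (Nat.le_succ V)) (H := 1)
    (by rintro _ ⟨f, hf, rfl⟩ u; exact filteredOn_mem_Icc f u) hε (by positivity) (by linarith) (by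
      have := dim_add_log_le hδ hδ1 hV0
      linarith)
  calc _ ≤ MeasureTheory.Measure.pi (fun _ : Fin n => μ)
        ({U | ∃ g ∈ mitigationOn X C e '' F, ε < |empiricalMean g U - ∫ u, g u ∂μ|}
          ∪ {U | ∃ g ∈ filteredOn X C e '' F, ε < |empiricalMean g U - ∫ u, g u ∂μ|}) := by
        refine MeasureTheory.measure_mono fun U hU => ?_
        by_contra hnot
        simp only [Set.mem_union, Set.mem_ofPred_eq, Set.exists_mem_image, not_or, not_exists,
          not_and, not_lt] at hnot
        exact hU fun f hf => ⟨hnot.1 f hf, hnot.2 f hf⟩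
    _ ≤ ENNReal.ofReal (δ / 2) + ENNReal.ofReal (δ / 2) :=
        (MeasureTheory.measure_union_le _ _).trans (add_le_add h1 h2)
    _ = ENNReal.ofReal δ := by
        rw [← ENNReal.ofReal_add (by positivity) (by positivity), add_halves]
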